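/- Let $\mathbb{K}$ be a field of characteristic zero and let $n, r$ be integers with $n\le 5$ and $2<r<n$. Let $E$ be the edge set of the complete graph $K_n$, and let $M=M_{K_n}^{r}$ be the truncation to rank $r$ of the graphic matroid of $K_n$: its ground set is $E$, and its bases are the $r$-element subsets of edge sets of spanning trees of $K_n$, that is, the edge sets of the forests with $r$ edges in $K_n$. Let $$\Phi_M=\sum_{B \text{ basis of } M}\ \prod_{e\in B}x_e\in\mathbb{K}[x_e\mid e\in E]$$ be its basis generating function, let $$\operatorname{Ann}(\Phi_M)=\Bigl\{P\in\mathbb{K}[x_e\mid e\in E]\ \Bigm|\ P\bigl(\tfrac{\partial}{\partial x_e}: e\in E\bigr)\Phi_M=0\Bigr\},$$ and let $A_M=\mathbb{K}[x_e\mid e\in E]/\operatorname{Ann}(\Phi_M)$, with $A_k$ the set of classes of the homogeneous polynomials of degree $k$. Then $A_M=\bigoplus_{k=0}^{r}A_k$ is a graded Artinian algebra with $A_r\ne 0$, and it has the strong Lefschetz property: there is an element $L\in A_1$ such that for every integer $k$ with $0\le k\le r/2$ the multiplication map $$\times L^{r-2k}\colon A_k\to A_{r-k}$$ is bijective (such an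 $L$ is called a strong Lefschetz element). Moreover, the class of the sum of all variables $\sum_{e\in E}x_e$ is a strong Lefschetz element. -/

import Mathlib

open MvPolynomial

/-! ### Graphic matroids and truncations -/

namespace LefschetzMatroid

/-- Exchange property of the edge sets of forests. -/
theorem forest_augment {V : Type*} [Finite V] {I J : Set (Sym2 V)}
    (hI : (SimpleGraph.fromEdgeSet I).IsAcyclic) (hJ : (SimpleGraph.fromEdgeSet J).IsAcyclic)
    (hJd : ∀ e ∈ J, ¬ e.IsDiag) (hlt : I.ncard < J.ncard) :
    ∃ e ∈ J, e ∉ I ∧ (SimpleGraph.fromEdgeSet (insert e I)).IsAcyclic := by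
  classical
  by_contra! hcon
  have hreach : ∀ u v : V, s(u, v) ∈ J → (SimpleGraph.fromEdgeSet I).Reachable u v := by
    intro u v huv
    by_cases huI : s(u, v) ∈ I
    · refine SimpleGraph.Adj.reachable ?_
      rw [SimpleGraph.fromEdgeSet_adj]
      exact ⟨huI, fun h => hJd _ huv (by simpa using h)⟩
    · by_contra hn
      apply hcon _ huv huI
      have h := (SimpleGraph.isAcyclic_add_edge_iff_of_not_reachable u v hn).2 hI
      rwa [SimpleGraph.edge, ← SimpleGraph.fromEdgeSet_union, Set.union_singleton] at h
  obtain ⟨e, he⟩ : J.Nonempty := by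
    rw [Set.nonempty_iff_ne_empty]; rintro rfl; simp at hlt
  have : Nonempty V := ⟨e.out.1⟩
  obtain ⟨T, hJT, -, hT⟩ := (SimpleGraph.connected_top (V := V)).exists_isTree_le_of_le_of_isAcyclic
    (le_top (a := SimpleGraph.fromEdgeSet J)) hJ
  have hJT' : J ⊆ T.edgeSet := by
    have h := SimpleGraph.edgeSet_mono hJT
    rw [SimpleGraph.edgeSet_fromEdgeSet] at h
    exact fun e he => h ⟨he, hJd e he⟩
  set G := SimpleGraph.fromEdgeSet ((T.edgeSet \ J) ∪ I) with hG
  have hIG : SimpleGraph.fromEdgeSet I ≤ G := SimpleGraph.fromEdgeSet_mono Set.subset_union_right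
  have hTG : ∀ u v, T.Adj u v → G.Reachable u v := by
    intro u v huv
    by_cases h : s(u, v) ∈ J
    · exact (hreach u v h).mono hIG
    · refine SimpleGraph.Adj.reachable ?_
      rw [hG, SimpleGraph.fromEdgeSet_adj]
      exact ⟨Or.inl ⟨huv, h⟩, huv.ne⟩
  have hGc : G.Connected := by
    refine ⟨fun u v => ?_⟩
    obtain ⟨p⟩ := hT.connected.preconnected u v
    induction p with
    | nil => exact SimpleGraph.Reachable.refl _
    | cons h _ ih => exact (hTG _ _ h).trans ih
  have h1 := hGc.card_vert_le_card_edgeSet_add_one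
  have h2 := (SimpleGraph.isTree_iff_connected_and_card.1 hT).2
  have h3 : Nat.card G.edgeSet ≤ (T.edgeSet \ J).ncard + I.ncard := by
    rw [Nat.card_coe_set_eq]
    refine (Set.ncard_le_ncard ?_ (Set.toFinite _)).trans (Set.ncard_union_le _ _)
    rw [hG, SimpleGraph.edgeSet_fromEdgeSet]
    exact Set.sdiff_subset
  have h4 := Set.ncard_sdiff_add_ncard_of_subset hJT' (Set.toFinite _)
  rw [Nat.card_coe_set_eq] at h2
  omega

/-- The graphic matroid of a finite graph `G`: its ground set is the edge set of `G`, and a set of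
edges is independent when it contains no cycle. -/
def graphicMatroid {V : Type*} [Finite V] (G : SimpleGraph V) : Matroid (Sym2 V) :=
  (IndepMatroid.ofFinite (E := G.edgeSet) (Set.toFinite _)
    (fun I => I ⊆ G.edgeSet ∧ (SimpleGraph.fromEdgeSet I).IsAcyclic)
    ⟨Set.empty_subset _, by simp⟩
    (fun _ _ hJ hIJ => ⟨hIJ.trans hJ.1, hJ.2.anti (SimpleGraph.fromEdgeSet_mono hIJ)⟩)
    (fun I J hI hJ hlt => by
      obtain ⟨e, heJ, heI, h⟩ := forest_augment hI.2 hJ.2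
        (fun e he => G.not_isDiag_of_mem_edgeSet (hJ.1 he)) hlt
      exact ⟨e, heJ, heI, Set.insert_subset (hJ.1 heJ) hI.1, h⟩)
    (fun _ hI => hI.1)).matroid

/-- The truncation of a matroid `M` to rank `r`: its independent sets are the independent sets of
`M` with at most `r` elements. -/
def truncation {α : Type*} (M : Matroid α) (r : ℕ) : Matroid α :=
  (IndepMatroid.ofBddAugment M.E (fun I => M.Indep I ∧ I.encard ≤ r)
    ⟨M.empty_indep, by simp⟩
    (fun _ _ hJ hIJ => ⟨hJ.1.subset hIJ, (Set.encard_le_encard hIJ).trans hJ.2⟩)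
    (fun I J hI hJ hlt => by
      obtain ⟨e, he, h⟩ := hI.1.augment hJ.1 hlt
      refine ⟨e, he.1, he.2, h, ?_⟩
      rw [Set.encard_insert_of_notMem he.2]
      exact (Order.add_one_le_of_lt hlt).trans hJ.2)
    ⟨r, fun _ hI => hI.2⟩
    (fun _ hI => hI.1.subset_ground)).matroid

/-- For a connected graph, the bases of the graphic matroid are the edge sets of spanning trees. -/
theorem graphicMatroid_isBase_iff {V : Type*} [Finite V] {G : SimpleGraph V} (hG : G.Connected)
    {B : Set (Sym2 V)} :
    (graphicMatroid G).IsBase B ↔ B ⊆ G.edgeSet ∧ (SimpleGraph.fromEdgeSet B).IsTree := by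
  have hle : ∀ {I : Set (Sym2 V)}, I ⊆ G.edgeSet → SimpleGraph.fromEdgeSet I ≤ G := fun h =>
    (SimpleGraph.fromEdgeSet_mono h).trans (SimpleGraph.fromEdgeSet_edgeSet G).le
  rw [Matroid.isBase_iff_maximal_indep]
  change Maximal (fun I => I ⊆ G.edgeSet ∧ (SimpleGraph.fromEdgeSet I).IsAcyclic) B ↔ _
  constructor
  · intro h
    refine ⟨h.prop.1, ?_⟩
    rw [← hG.maximal_le_isAcyclic_iff_isTree (hle h.prop.1)]
    refine ⟨⟨hle h.prop.1, h.prop.2⟩, fun H hH hBH => ?_⟩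
    have hB : B ⊆ H.edgeSet := by
      have h' := SimpleGraph.edgeSet_mono hBH
      rw [SimpleGraph.edgeSet_fromEdgeSet] at h'
      exact fun e he => h' ⟨he, G.not_isDiag_of_mem_edgeSet (h.prop.1 he)⟩
    have := h.le_of_ge (y := H.edgeSet)
      ⟨SimpleGraph.edgeSet_mono hH.1, by simpa using hH.2⟩ hB
    exact (SimpleGraph.fromEdgeSet_edgeSet H).ge.trans (SimpleGraph.fromEdgeSet_mono this)
  · rintro ⟨hB, hT⟩
    have hm := (hG.maximal_le_isAcyclic_iff_isTree (hle hB)).2 hT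
    refine ⟨⟨hB, hT.2⟩, fun I hI hBI e he => ?_⟩
    have h' := SimpleGraph.edgeSet_mono
      (hm.le_of_ge ⟨hle hI.1, hI.2⟩ (SimpleGraph.fromEdgeSet_mono hBI))
    rw [SimpleGraph.edgeSet_fromEdgeSet, SimpleGraph.edgeSet_fromEdgeSet] at h'
    exact (h' ⟨he, G.not_isDiag_of_mem_edgeSet (hI.1 he)⟩).1

/-- When `r` is at most the rank of `M`, the bases of the truncation are the `r`-element subsets of
bases of `M`. -/
theorem truncation_isBase_iff {α : Type*} {M : Matroid α} {r : ℕ} (hr : r ≤ M.eRank)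
    {B : Set α} :
    (truncation M r).IsBase B ↔ B.encard = r ∧ ∃ B', M.IsBase B' ∧ B ⊆ B' := by
  rw [Matroid.isBase_iff_maximal_indep]
  change Maximal (fun I => M.Indep I ∧ I.encard ≤ r) B ↔ _
  constructor
  · intro h
    refine ⟨le_antisymm h.prop.2 ?_, h.prop.1.exists_isBase_superset⟩
    by_contra! hlt
    obtain ⟨B', hB', hBB'⟩ := h.prop.1.exists_isBase_superset
    obtain ⟨e, he⟩ : (B' \ B).Nonempty := by
      rw [Set.nonempty_iff_ne_empty, Ne, Set.sdiff_eq_empty]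
      intro hs
      rw [← hB'.encard_eq_eRank] at hr
      exact absurd (hr.trans (Set.encard_le_encard hs)) (not_le.2 hlt)
    have := h.le_of_ge (y := insert e B)
      ⟨hB'.indep.subset (Set.insert_subset he.1 hBB'), by
        rw [Set.encard_insert_of_notMem he.2]; exact Order.add_one_le_of_lt hlt⟩
      (Set.subset_insert _ _)
    exact he.2 (this (Set.mem_insert _ _))
  · rintro ⟨hc, B', hB', hs⟩
    refine ⟨⟨hB'.indep.subset hs, hc.le⟩, fun I hI hBI => ?_⟩
    have hI' : I.encard ≤ B.encard := hI.2.trans hc.ge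
    exact (Set.Finite.eq_of_subset_of_encard_le' (Set.finite_of_encard_le_coe hI.2) hBI hI').ge

/-! ### The algebra of a matroid -/

section Algebra

variable {σ : Type*} (𝕜 : Type*) [Field 𝕜]

theorem pderiv_mul_comm (i j : σ) :
    ((pderiv i).toLinearMap * (pderiv j).toLinearMap : Module.End 𝕜 (MvPolynomial σ 𝕜)) =
      (pderiv j).toLinearMap * (pderiv i).toLinearMap := by
  classical
  have h : ⁅(pderiv i : Derivation 𝕜 (MvPolynomial σ 𝕜) (MvPolynomial σ 𝕜)),
      (pderiv j : Derivation 𝕜 (MvPolynomial σ 𝕜) (MvPolynomial σ 𝕜))⁆ = 0 := by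
    refine MvPolynomial.derivation_ext fun k => ?_
    simp only [Derivation.commutator_apply, Derivation.coe_zero, Pi.zero_apply, pderiv_X,
      Pi.single_apply]
    split_ifs <;> simp
  refine LinearMap.ext fun p => ?_
  have h' := DFunLike.congr_fun h p
  rw [Derivation.commutator_apply, Derivation.coe_zero, Pi.zero_apply, sub_eq_zero] at h'
  exact h'

open scoped IsMulCommutative in
/-- The polynomial differential operator `P(∂)`, as an algebra homomorphism in `P`; it is determined
by `X i ↦ ∂ / ∂ x_i`. -/
noncomputable def diffOp : MvPolynomial σ 𝕜 →ₐ[𝕜] Module.End 𝕜 (MvPolynomial σ 𝕜) :=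
  let s : Set (Module.End 𝕜 (MvPolynomial σ 𝕜)) := Set.range fun i => (pderiv i).toLinearMap
  haveI : IsMulCommutative (Algebra.adjoin 𝕜 s) := Algebra.isMulCommutative_adjoin 𝕜 (by
    rintro _ ⟨i, rfl⟩ _ ⟨j, rfl⟩
    exact pderiv_mul_comm 𝕜 i j)
  (Algebra.adjoin 𝕜 s).val.comp
    (aeval fun i => (⟨(pderiv i).toLinearMap, Algebra.subset_adjoin ⟨i, rfl⟩⟩ : Algebra.adjoin 𝕜 s))

theorem diffOp_X (i : σ) : diffOp 𝕜 (X i) = (pderiv i).toLinearMap := by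
  simp only [diffOp, AlgHom.comp_apply, aeval_X]
  rfl

variable {𝕜}

/-- `Ann(Φ)`: the ideal of polynomials `P` with `P(∂) Φ = 0`. -/
noncomputable def annihilator (Φ : MvPolynomial σ 𝕜) : Ideal (MvPolynomial σ 𝕜) where
  carrier := {P | diffOp 𝕜 P Φ = 0}
  zero_mem' := by simp
  add_mem' := by
    intro P Q hP hQ
    simp only [Set.mem_ofPred_eq] at *
    simp [hP, hQ]
  smul_mem' := by
    intro P Q hQ
    simp only [Set.mem_ofPred_eq, smul_eq_mul, map_mul, Module.End.mul_apply] at *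
    rw [hQ, map_zero]

/-- The degree-`k` part of `𝕜[x] ⧸ I`: the classes of the homogeneous polynomials of degree `k`. -/
noncomputable def quotientGrading (I : Ideal (MvPolynomial σ 𝕜)) (k : ℕ) : Submodule 𝕜 (MvPolynomial σ 𝕜 ⧸ I) :=
  (homogeneousSubmodule σ 𝕜 k).map (Ideal.Quotient.mkₐ 𝕜 I).toLinearMap

variable (𝕜) {α : Type*} (M : Matroid α) [M.Finite]

/-- The basis generating function `∑_B ∏_{b ∈ B} x_b` of a matroid on a finite ground set, a
polynomial in the variables indexed by the ground set. -/
noncomputable def basisGeneratingFunction : MvPolynomial M.E 𝕜 :=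
  ∑ᶠ (B : Finset M.E) (_ : M.IsBase (Subtype.val '' (B : Set M.E))), ∏ b ∈ B, X b

/-- The algebra `A_M = 𝕜[x_e | e ∈ E] ⧸ Ann(Φ_M)`. -/
abbrev MatroidAlgebra : Type _ :=
  MvPolynomial M.E 𝕜 ⧸ annihilator (basisGeneratingFunction 𝕜 M)

/-- The grading of `A_M` by degree. -/
noncomputable def matroidAlgebraGrading : ℕ → Submodule 𝕜 (MatroidAlgebra 𝕜 M) :=
  quotientGrading (annihilator (basisGeneratingFunction 𝕜 M))

/-- The class of the sum of all variables in `A_M`. -/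
noncomputable def sumOfVariables : MatroidAlgebra 𝕜 M :=
  Ideal.Quotient.mk _ (∑ᶠ e : M.E, X e)

end Algebra

/-! ### The strong Lefschetz property -/

section Lefschetz

variable {𝕜 A : Type*} [Field 𝕜] [CommRing A] [Algebra 𝕜 A] (𝒜 : ℕ → Submodule 𝕜 A)

/-- `A = ⨁_{k=0}^s 𝒜 k` is a graded Artinian algebra with `𝒜 s ≠ 0`. -/
structure IsGradedArtinian (s : ℕ) : Prop where
  gradedMonoid : SetLike.GradedMonoid 𝒜
  isInternal : DirectSum.IsInternal 𝒜
  isArtinianRing : IsArtinianRing A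
  top_ne_bot : 𝒜 s ≠ ⊥
  eq_bot_of_lt : ∀ k, s < k → 𝒜 k = ⊥

/-- `L` is a strong Lefschetz element of the graded Artinian algebra `A = ⨁_{k=0}^s 𝒜 k`:
it has degree one, and multiplication by `L ^ (s - 2 k)` is a bijection from `𝒜 k` onto
`𝒜 (s - k)` for all `k ≤ s / 2`. -/
structure IsStrongLefschetzElement (s : ℕ) (L : A) : Prop where
  isGradedArtinian : IsGradedArtinian 𝒜 s
  mem_one : L ∈ 𝒜 1
  bijOn : ∀ k, 2 * k ≤ s → Set.BijOn (fun a => L ^ (s - 2 * k) * a) (𝒜 k) (𝒜 (s - k))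

/-- The strong Lefschetz property of a graded Artinian algebra. -/
def HasStrongLefschetzProperty : Prop :=
  ∃ (s : ℕ) (L : A), IsStrongLefschetzElement 𝒜 s L

end Lefschetz

end LefschetzMatroid

/-! The conditions 2 < r < n ≤ 5 leave (n, r) = (4, 3), (5, 3), (5, 4), so r ≤ 4 and only the maps
in degrees k = 0 and k = 1 need work; for 2k = r the map is the identity.

Let L be the sum of all variables. Iterating Euler's identity at the point (1, …, 1) gives L(∂)^d Ψ
= d! Ψ(1, …, 1) for Ψ homogeneous of degree d (`eval_one_diffOp_sum_X_pow`). For k = 0 it makes L^r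
bijective when Φ(1, …, 1) ≠ 0, a number that counts bases. For k = 1, applied to the second
derivatives of Φ, it shows that the gradient of L^(r-2)(∂) ℓ_c(∂) Φ is (r-2)! H c, where ℓ_c is the
linear form with coefficients c and H is the Hessian of Φ at (1, …, 1)
(`eval_one_pderiv_diffOp_linear`). So invertibility of H suffices.

As Φ is squarefree, H has zero diagonal, and its other entries count the r-edge forests through two
given edges. By symmetry such an entry depends only on whether the edges meet, so H lies in the
three-dimensional algebra of the association scheme on the edges of K_n. An inverse up to scale is
sought in the same algebra; the counts and the matrix product are checked by kernel computation
(`IsEdgeList.isStrongLefschetzElement`). -/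

namespace LefschetzMatroid

open MvPolynomial

/-! ### Differential operators on homogeneous polynomials and Euler's identity -/

section DiffOp

variable {σ 𝕜 : Type*} [Field 𝕜]

theorem diffOp_C_apply (c : 𝕜) (Ψ : MvPolynomial σ 𝕜) : diffOp 𝕜 (C c) Ψ = c • Ψ := by
  rw [← algebraMap_eq, AlgHom.commutes]
  rfl

theorem diffOp_X_apply (i : σ) (Ψ : MvPolynomial σ 𝕜) : diffOp 𝕜 (X i) Ψ = pderiv i Ψ := by
  rw [diffOp_X]
  rfl

theorem mem_annihilator {Φ P : MvPolynomial σ 𝕜} : P ∈ annihilator Φ ↔ diffOp 𝕜 P Φ = 0 :=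
  Iff.rfl

/-- The subtraction is truncated, so homogeneity alone says too little when d < |m|; the vanishing
in that range is carried through the same induction. -/
theorem diffOp_monomial_isHomogeneous (m : σ →₀ ℕ) :
    ∀ {d : ℕ} {Ψ : MvPolynomial σ 𝕜}, Ψ.IsHomogeneous d →
      (diffOp 𝕜 (monomial m 1) Ψ).IsHomogeneous (d - m.degree) ∧
        (d < m.degree → diffOp 𝕜 (monomial m 1) Ψ = 0) := by
  induction m using Finsupp.induction_linear with
  | zero =>
    intro d Ψ hΨ
    rw [show (monomial 0 1 : MvPolynomial σ 𝕜) = 1 from rfl]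
    simpa using hΨ
  | add m₁ m₂ h₁ h₂ =>
    intro d Ψ hΨ
    rw [show (monomial (m₁ + m₂) 1 : MvPolynomial σ 𝕜) = monomial m₁ 1 * monomial m₂ 1 by
      rw [monomial_mul, one_mul], map_mul, Module.End.mul_apply, map_add]
    obtain ⟨a, b⟩ := h₂ hΨ
    obtain ⟨a', b'⟩ := h₁ a
    refine ⟨by rwa [add_comm, ← Nat.sub_sub], fun hlt => ?_⟩
    rcases lt_or_ge d m₂.degree with h | h
    · rw [b h, map_zero]
    · exact b' (by omega)
  | single i n =>
    induction n with
    | zero =>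
      intro d Ψ hΨ
      rw [Finsupp.single_zero, show (monomial 0 1 : MvPolynomial σ 𝕜) = 1 from rfl]
      simpa using hΨ
    | succ n ih =>
      intro d Ψ hΨ
      rw [← X_pow_eq_monomial, pow_succ', map_mul, Module.End.mul_apply, diffOp_X_apply,
        X_pow_eq_monomial, Finsupp.degree_single]
      obtain ⟨a, b⟩ := ih hΨ
      rw [Finsupp.degree_single] at a b
      refine ⟨by simpa [Nat.sub_sub] using a.pderiv, fun hlt => ?_⟩
      rcases lt_or_ge d n with h | h
      · rw [b h, map_zero]
      -- Here d = n: the first n derivatives leave a constant, which the last one kills.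
      · rw [show d - n = 0 by omega, ← totalDegree_zero_iff_isHomogeneous,
          totalDegree_eq_zero_iff_eq_C] at a
        rw [a, pderiv_C]

theorem diffOp_isHomogeneous {p Ψ : MvPolynomial σ 𝕜} {k d : ℕ} (hp : p.IsHomogeneous k)
    (hΨ : Ψ.IsHomogeneous d) : (diffOp 𝕜 p Ψ).IsHomogeneous (d - k) := by
  rw [p.as_sum, map_sum, LinearMap.sum_apply]
  refine IsHomogeneous.sum _ _ _ fun m hm => ?_
  have hm' : m.degree = k := by
    rw [Finsupp.degree_eq_weight_one]
    exact hp (mem_support_iff.1 hm)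
  rw [← hm', ← mul_one (coeff m p), ← C_mul_monomial, map_mul, Module.End.mul_apply,
    diffOp_C_apply]
  exact (homogeneousSubmodule σ 𝕜 _).smul_mem _ (diffOp_monomial_isHomogeneous m hΨ).1

theorem diffOp_eq_zero_of_lt {p Ψ : MvPolynomial σ 𝕜} {k d : ℕ} (hp : p.IsHomogeneous k)
    (hΨ : Ψ.IsHomogeneous d) (hlt : d < k) : diffOp 𝕜 p Ψ = 0 := by
  rw [p.as_sum, map_sum, LinearMap.sum_apply]
  refine Finset.sum_eq_zero fun m hm => ?_
  have hm' : m.degree = k := by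
    rw [Finsupp.degree_eq_weight_one]
    exact hp (mem_support_iff.1 hm)
  rw [← mul_one (coeff m p), ← C_mul_monomial, map_mul, Module.End.mul_apply,
    diffOp_C_apply, (diffOp_monomial_isHomogeneous m hΨ).2 (by omega), smul_zero]

/-- A homogeneous polynomial of positive degree with vanishing partial derivatives is zero. -/
theorem eq_zero_of_forall_pderiv_eq_zero [Fintype σ] [CharZero 𝕜] {Ψ : MvPolynomial σ 𝕜} {d : ℕ}
    (hΨ : Ψ.IsHomogeneous d) (hd : d ≠ 0) (h : ∀ i, pderiv i Ψ = 0) : Ψ = 0 := by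
  have he := hΨ.sum_X_mul_pderiv
  simp only [h, mul_zero, Finset.sum_const_zero] at he
  exact (smul_eq_zero.1 he.symm).resolve_left hd

theorem eq_C_eval_of_isHomogeneous_zero {Ψ : MvPolynomial σ 𝕜} (hΨ : Ψ.IsHomogeneous 0)
    (x : σ → 𝕜) : Ψ = C (eval x Ψ) := by
  rw [← totalDegree_zero_iff_isHomogeneous, totalDegree_eq_zero_iff_eq_C] at hΨ
  rw [hΨ, eval_C]

/-- At (1, …, 1) the Euler operator ∑ x_i ∂_i and the operator ∑ ∂_i take the same value. -/
theorem eval_one_diffOp_sum_X [Fintype σ] {Ψ : MvPolynomial σ 𝕜} {d : ℕ}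
    (hΨ : Ψ.IsHomogeneous d) :
    eval 1 (diffOp 𝕜 (∑ i, X i) Ψ) = d * eval 1 Ψ := by
  have he := congrArg (eval (1 : σ → 𝕜)) hΨ.sum_X_mul_pderiv
  rw [map_sum, LinearMap.sum_apply, map_sum]
  simpa [diffOp_X_apply] using he

theorem isHomogeneous_sum_X (σ 𝕜 : Type*) [Fintype σ] [Field 𝕜] :
    (∑ i, X i : MvPolynomial σ 𝕜).IsHomogeneous 1 :=
  IsHomogeneous.sum _ _ _ fun i _ => isHomogeneous_X 𝕜 i

theorem eval_one_diffOp_sum_X_pow [Fintype σ] :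
    ∀ (d : ℕ) {Ψ : MvPolynomial σ 𝕜}, Ψ.IsHomogeneous d →
      eval 1 (diffOp 𝕜 ((∑ i, X i) ^ d) Ψ) = d.factorial * eval 1 Ψ
  | 0, Ψ, _ => by simp
  | d + 1, Ψ, hΨ => by
    rw [pow_succ, map_mul, Module.End.mul_apply,
      eval_one_diffOp_sum_X_pow d (diffOp_isHomogeneous (isHomogeneous_sum_X σ 𝕜) hΨ),
      eval_one_diffOp_sum_X hΨ, Nat.factorial_succ]
    push_cast
    ring

end DiffOp

/-! ### The graded quotient by an annihilator and its Lefschetz maps -/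

section Grading

variable {σ 𝕜 : Type*} [Field 𝕜]

theorem mem_quotientGrading {I : Ideal (MvPolynomial σ 𝕜)} {k : ℕ} {a : MvPolynomial σ 𝕜 ⧸ I} :
    a ∈ quotientGrading I k ↔ ∃ p : MvPolynomial σ 𝕜, p.IsHomogeneous k ∧ Ideal.Quotient.mk I p = a :=
  Iff.rfl

theorem quotientGrading_gradedMonoid (I : Ideal (MvPolynomial σ 𝕜)) :
    SetLike.GradedMonoid (quotientGrading I) where
  one_mem := ⟨1, isHomogeneous_one σ 𝕜, map_one (Ideal.Quotient.mk I)⟩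
  mul_mem := by
    rintro i j _ _ ⟨p, hp, rfl⟩ ⟨q, hq, rfl⟩
    exact ⟨p * q, hp.mul hq, map_mul (Ideal.Quotient.mk I) _ _⟩

theorem quotientGrading_iSup (I : Ideal (MvPolynomial σ 𝕜)) : ⨆ k, quotientGrading I k = ⊤ := by
  refine eq_top_iff.2 fun a _ => ?_
  obtain ⟨p, rfl⟩ := Ideal.Quotient.mk_surjective a
  rw [← sum_homogeneousComponent p, map_sum]
  exact Submodule.sum_mem _ fun k _ => Submodule.mem_iSup_of_mem k
    ⟨_, homogeneousComponent_isHomogeneous k p, rfl⟩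

variable {Φ : MvPolynomial σ 𝕜} {r : ℕ}

/-- The annihilator of a homogeneous polynomial is a homogeneous ideal: components of P of degree i
≤ r send Φ to the distinct degrees r - i, and those of degree above r kill Φ. -/
theorem quotientGrading_annihilator_iSupIndep (hΦ : Φ.IsHomogeneous r) :
    iSupIndep (quotientGrading (annihilator Φ)) := by
  rw [iSupIndep_iff_finsetSum_eq_zero_imp_eq_zero]
  intro s v hv hs
  choose! p hp hpv using fun i (hi : i ∈ s) => mem_quotientGrading.1 (hv i hi)
  have hsum : ∑ i ∈ s, diffOp 𝕜 (p i) Φ = 0 := by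
    rw [← LinearMap.sum_apply, ← map_sum, ← mem_annihilator, ← Ideal.Quotient.eq_zero_iff_mem,
      map_sum, ← hs]
    exact Finset.sum_congr rfl hpv
  intro i hi
  rw [← hpv i hi, Ideal.Quotient.eq_zero_iff_mem, mem_annihilator]
  rcases lt_or_ge r i with hir | hir
  · exact diffOp_eq_zero_of_lt (hp i hi) hΦ hir
  have hc := congrArg (homogeneousComponent (r - i)) hsum
  rw [map_sum, map_zero, Finset.sum_eq_single i] at hc
  · rwa [homogeneousComponent_eq_self (diffOp_isHomogeneous (hp i hi) hΦ)] at hc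
  · intro j hj hji
    rcases lt_or_ge r j with hjr | hjr
    · rw [diffOp_eq_zero_of_lt (hp j hj) hΦ hjr, map_zero]
    · rw [homogeneousComponent_of_mem (diffOp_isHomogeneous (hp j hj) hΦ), if_neg (by omega)]
  · exact fun h => absurd hi h

theorem quotientGrading_annihilator_eq_bot (hΦ : Φ.IsHomogeneous r) {k : ℕ} (hk : r < k) :
    quotientGrading (annihilator Φ) k = ⊥ := by
  refine eq_bot_iff.2 ?_
  rintro _ ⟨p, hp, rfl⟩
  exact Ideal.Quotient.eq_zero_iff_mem.2 (diffOp_eq_zero_of_lt hp hΦ hk)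

/-- Only the degrees 0, …, r contribute, and each is spanned by finitely many monomials. -/
theorem finite_quotient_annihilator [Finite σ] (hΦ : Φ.IsHomogeneous r) :
    Module.Finite 𝕜 (MvPolynomial σ 𝕜 ⧸ annihilator Φ) := by
  refine ⟨?_⟩
  have h : (⊤ : Submodule 𝕜 (MvPolynomial σ 𝕜 ⧸ annihilator Φ)) =
      ⨆ k : Fin (r + 1), quotientGrading (annihilator Φ) k := by
    refine le_antisymm ?_ le_top
    rw [← quotientGrading_iSup]
    refine iSup_le fun k => ?_
    rcases lt_or_ge r k with hk | hk
    · rw [quotientGrading_annihilator_eq_bot hΦ hk]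
      exact bot_le
    · exact le_iSup (fun k : Fin (r + 1) => quotientGrading (annihilator Φ) k)
        ⟨k, by omega⟩
  rw [h]
  exact Submodule.fg_iSup _ fun k => (homogeneousSubmodule_fg σ 𝕜 _).map _

variable [Fintype σ]

theorem isGradedArtinian_quotientGrading [CharZero 𝕜] (hΦ : Φ.IsHomogeneous r) (h0 : eval 1 Φ ≠ 0) :
    IsGradedArtinian (quotientGrading (annihilator Φ)) r where
  gradedMonoid := quotientGrading_gradedMonoid _
  isInternal := (DirectSum.isInternal_submodule_iff_iSupIndep_and_iSup_eq_top _).2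
    ⟨quotientGrading_annihilator_iSupIndep hΦ, quotientGrading_iSup _⟩
  isArtinianRing := by
    have := finite_quotient_annihilator hΦ
    exact isArtinian_of_tower 𝕜 inferInstance
  top_ne_bot := by
    intro hbot
    -- The class of L^r is a nonzero element of top degree, since L^r(∂) Φ = r! Φ(1, …, 1).
    have hmem : Ideal.Quotient.mk (annihilator Φ) ((∑ i, X i) ^ r) ∈
        quotientGrading (annihilator Φ) r :=
      ⟨_, by simpa using (isHomogeneous_sum_X σ 𝕜).pow r, rfl⟩
    rw [hbot, Submodule.mem_bot, Ideal.Quotient.eq_zero_iff_mem, mem_annihilator] at hmem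
    have := eval_one_diffOp_sum_X_pow r hΦ
    rw [hmem, map_zero] at this
    exact mul_ne_zero (Nat.cast_ne_zero.2 r.factorial_ne_zero) h0 this.symm
  eq_bot_of_lt _ hk := quotientGrading_annihilator_eq_bot hΦ hk

/-- The Hessian matrix of `Φ` at the point `(1, …, 1)`. -/
noncomputable def hessianAtOne (Φ : MvPolynomial σ 𝕜) : Matrix σ σ 𝕜 :=
  Matrix.of fun i j => eval 1 (pderiv i (pderiv j Φ))

theorem bijOn_mul_pow_zero [CharZero 𝕜] (hΦ : Φ.IsHomogeneous r) (h0 : eval 1 Φ ≠ 0) :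
    Set.BijOn (fun a => Ideal.Quotient.mk (annihilator Φ) (∑ i, X i) ^ r * a)
      (quotientGrading (annihilator Φ) 0) (quotientGrading (annihilator Φ) r) := by
  have hL : ((∑ i, X i : MvPolynomial σ 𝕜) ^ r).IsHomogeneous r := by
    simpa using (isHomogeneous_sum_X σ 𝕜).pow r
  have hne : (r.factorial * eval 1 Φ : 𝕜) ≠ 0 :=
    mul_ne_zero (Nat.cast_ne_zero.2 r.factorial_ne_zero) h0
  have hev : ∀ c : 𝕜, eval 1 (diffOp 𝕜 ((∑ i, X i) ^ r * C c) Φ) = c * (r.factorial * eval 1 Φ) := by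
    intro c
    rw [mul_comm, map_mul, Module.End.mul_apply, diffOp_C_apply, smul_eval,
      eval_one_diffOp_sum_X_pow r hΦ]
  refine ⟨?_, ?_, ?_⟩
  · rintro _ ⟨p, hp, rfl⟩
    exact ⟨(∑ i, X i) ^ r * p, by simpa using hL.mul hp, by simp⟩
  · refine Set.InjOn.mono (s₂ := quotientGrading (annihilator Φ) 0) subset_rfl ?_
    rintro _ ⟨p, hp, rfl⟩ _ ⟨q, hq, rfl⟩ h
    rw [SetLike.mem_coe, mem_homogeneousSubmodule] at hp hq
    rw [eq_C_eval_of_isHomogeneous_zero hp 1, eq_C_eval_of_isHomogeneous_zero hq 1] at h ⊢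
    have h' : Ideal.Quotient.mk (annihilator Φ) ((∑ i, X i) ^ r * C (eval 1 p)) =
      Ideal.Quotient.mk (annihilator Φ) ((∑ i, X i) ^ r * C (eval 1 q)) := by
      rw [map_mul, map_mul, map_pow]
      exact h
    rw [Ideal.Quotient.eq, mem_annihilator, map_sub, LinearMap.sub_apply, sub_eq_zero] at h'
    have h'' := congrArg (eval 1) h'
    rw [hev, hev] at h''
    rw [mul_right_cancel₀ hne h'']
  · rintro _ ⟨p, hp, rfl⟩
    -- In top degree P(∂) Φ is a constant, so the class of P is determined by it; the preimage
    -- rescales L^r to give the same constant.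
    refine ⟨Ideal.Quotient.mk _ (C (eval 1 (diffOp 𝕜 p Φ) / (r.factorial * eval 1 Φ))),
      ⟨_, isHomogeneous_C _ _, rfl⟩, ?_⟩
    change _ = Ideal.Quotient.mk _ p
    dsimp only
    rw [← map_pow, ← map_mul, Ideal.Quotient.eq, mem_annihilator]
    have hd : (diffOp 𝕜 ((∑ i, X i) ^ r * C (eval 1 (diffOp 𝕜 p Φ) / (r.factorial * eval 1 Φ)) - p)
        Φ).IsHomogeneous 0 := by
      rw [← Nat.sub_self r]
      refine diffOp_isHomogeneous (IsHomogeneous.sub ?_ hp) hΦ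
      simpa using hL.mul (isHomogeneous_C σ _)
    rw [eq_C_eval_of_isHomogeneous_zero hd 1, map_sub, LinearMap.sub_apply, map_sub, hev,
      div_mul_cancel₀ _ hne, sub_self, map_zero]

/-- All operators commute, so ∂_j and the linear form act on Φ before L^(r-2), which then meets a
polynomial of degree r - 2 and contributes the factor (r-2)!. -/
theorem eval_one_pderiv_diffOp_linear (hΦ : Φ.IsHomogeneous r) (c : σ → 𝕜) (j : σ) :
    eval 1 (pderiv j (diffOp 𝕜 ((∑ i, X i) ^ (r - 2) * ∑ i, C (c i) * X i) Φ)) =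
      (r - 2).factorial * (hessianAtOne Φ).mulVec c j := by
  have hX : ∀ i : σ, (diffOp 𝕜 (X j * X i) Φ).IsHomogeneous (r - 2) := fun i =>
    diffOp_isHomogeneous ((isHomogeneous_X 𝕜 j).mul (isHomogeneous_X 𝕜 i)) hΦ
  rw [← diffOp_X_apply, ← Module.End.mul_apply, ← map_mul, mul_left_comm, Finset.mul_sum,
    Finset.mul_sum, map_sum, LinearMap.sum_apply, map_sum, Matrix.mulVec, dotProduct,
    Finset.mul_sum]
  refine Finset.sum_congr rfl fun i _ => ?_
  rw [show (∑ i, X i : MvPolynomial σ 𝕜) ^ (r - 2) * (X j * (C (c i) * X i)) =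
    C (c i) * ((∑ i, X i) ^ (r - 2) * (X j * X i)) by ring, map_mul, Module.End.mul_apply,
    diffOp_C_apply, smul_eval, map_mul, Module.End.mul_apply,
    eval_one_diffOp_sum_X_pow _ (hX i), map_mul, Module.End.mul_apply, diffOp_X_apply,
    diffOp_X_apply, hessianAtOne, Matrix.of_apply]
  ring

theorem exists_linear_of_isHomogeneous_one {p : MvPolynomial σ 𝕜} (hp : p.IsHomogeneous 1) :
    ∃ c : σ → 𝕜, p = ∑ i, C (c i) * X i := by
  rw [← mem_homogeneousSubmodule, homogeneousSubmodule_one_eq_span_X,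
    Submodule.mem_span_range_iff_exists_fun] at hp
  obtain ⟨c, rfl⟩ := hp
  exact ⟨c, by simp only [smul_eq_C_mul]⟩

theorem isHomogeneous_linear (c : σ → 𝕜) : (∑ i, C (c i) * X i).IsHomogeneous 1 :=
  IsHomogeneous.sum _ _ _ fun i _ => by
    simpa using (isHomogeneous_C σ (c i)).mul (isHomogeneous_X 𝕜 i)

theorem bijOn_mul_pow_one [CharZero 𝕜] [DecidableEq σ] (hΦ : Φ.IsHomogeneous r) (hr : 2 ≤ r)
    (hH : IsUnit (hessianAtOne Φ)) :
    Set.BijOn (fun a => Ideal.Quotient.mk (annihilator Φ) (∑ i, X i) ^ (r - 2) * a)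
      (quotientGrading (annihilator Φ) 1) (quotientGrading (annihilator Φ) (r - 1)) := by
  have hL : ((∑ i, X i : MvPolynomial σ 𝕜) ^ (r - 2)).IsHomogeneous (r - 2) := by
    simpa using (isHomogeneous_sum_X σ 𝕜).pow (r - 2)
  have hLc : ∀ {p : MvPolynomial σ 𝕜}, p.IsHomogeneous 1 →
      ((∑ i, X i) ^ (r - 2) * p).IsHomogeneous (r - 1) := by
    intro p hp
    have := hL.mul hp
    rwa [show r - 2 + 1 = r - 1 by omega] at this
  have hne : ((r - 2).factorial : 𝕜) ≠ 0 := Nat.cast_ne_zero.2 (Nat.factorial_ne_zero _)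
  refine ⟨?_, ?_, ?_⟩
  · rintro _ ⟨p, hp, rfl⟩
    exact ⟨(∑ i, X i) ^ (r - 2) * p, hLc hp, by simp⟩
  · rintro _ ⟨p, hp, rfl⟩ _ ⟨q, hq, rfl⟩ h
    obtain ⟨c, rfl⟩ := exists_linear_of_isHomogeneous_one hp
    obtain ⟨c', rfl⟩ := exists_linear_of_isHomogeneous_one hq
    have h' : Ideal.Quotient.mk (annihilator Φ) ((∑ i, X i) ^ (r - 2) * ∑ i, C (c i) * X i) =
        Ideal.Quotient.mk (annihilator Φ) ((∑ i, X i) ^ (r - 2) * ∑ i, C (c' i) * X i) := by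
      simpa using h
    rw [Ideal.Quotient.eq, mem_annihilator, map_sub, LinearMap.sub_apply, sub_eq_zero] at h'
    have hcc : c = c' := by
      refine Matrix.mulVec_injective_iff_isUnit.2 hH (funext fun j => ?_)
      have h'' := congrArg (fun Ψ => eval 1 (pderiv j Ψ)) h'
      simp only [eval_one_pderiv_diffOp_linear hΦ] at h''
      exact mul_left_cancel₀ hne h''
    rw [hcc]
  · rintro _ ⟨p, hp, rfl⟩
    obtain ⟨c, hc⟩ := Matrix.mulVec_surjective_iff_isUnit.2 hH
      fun j => eval 1 (pderiv j (diffOp 𝕜 p Φ)) / (r - 2).factorial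
    refine ⟨Ideal.Quotient.mk _ (∑ i, C (c i) * X i), ⟨_, isHomogeneous_linear c, rfl⟩, ?_⟩
    change _ = Ideal.Quotient.mk _ p
    dsimp only
    rw [← map_pow, ← map_mul, Ideal.Quotient.eq, mem_annihilator]
    have hd : (diffOp 𝕜 ((∑ i, X i) ^ (r - 2) * ∑ i, C (c i) * X i - p) Φ).IsHomogeneous 1 := by
      have := diffOp_isHomogeneous ((hLc (isHomogeneous_linear c)).sub hp) hΦ
      rwa [show r - (r - 1) = 1 by omega] at this
    -- The difference sends Φ to a linear form, which vanishes once its constant partial derivatives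
    -- do; c was chosen to match them.
    refine eq_zero_of_forall_pderiv_eq_zero hd one_ne_zero fun j => ?_
    rw [eq_C_eval_of_isHomogeneous_zero hd.pderiv 1, map_sub, LinearMap.sub_apply, map_sub,
      map_sub, eval_one_pderiv_diffOp_linear hΦ, hc, mul_div_cancel₀ _ hne, sub_self, map_zero]

/-- In degree at most four, the sum of all variables is a strong Lefschetz element as soon as `Φ`
and the determinant of its Hessian do not vanish at `(1, …, 1)`. -/
theorem isStrongLefschetzElement_of_isUnit_hessian [CharZero 𝕜] [DecidableEq σ] (hΦ : Φ.IsHomogeneous r)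
    (hr : r ≤ 4) (h0 : eval 1 Φ ≠ 0) (hH : IsUnit (hessianAtOne Φ)) :
    IsStrongLefschetzElement (quotientGrading (annihilator Φ)) r
      (Ideal.Quotient.mk (annihilator Φ) (∑ i, X i)) where
  isGradedArtinian := isGradedArtinian_quotientGrading hΦ h0
  mem_one := ⟨_, isHomogeneous_sum_X σ 𝕜, rfl⟩
  bijOn k hk := by
    rcases eq_or_ne (2 * k) r with rfl | hne
    · simpa [show 2 * k - k = k by omega, Function.id_def] using
        Set.bijOn_id (quotientGrading (annihilator Φ) k : Set (MvPolynomial σ 𝕜 ⧸ annihilator Φ))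
    obtain rfl | rfl : k = 0 ∨ k = 1 := by omega
    · simpa using bijOn_mul_pow_zero hΦ h0
    · exact bijOn_mul_pow_one hΦ hk hH

end Grading

/-! ### Hessians of squarefree generating functions -/

section SquareFree

variable {σ 𝕜 : Type*} [Field 𝕜]

theorem pderiv_prod_X [DecidableEq σ] (j : σ) (B : Finset σ) :
    pderiv j (∏ b ∈ B, X b : MvPolynomial σ 𝕜) = if j ∈ B then ∏ b ∈ B.erase j, X b else 0 := by
  have h0 : ∀ B : Finset σ, j ∉ B → pderiv j (∏ b ∈ B, X b : MvPolynomial σ 𝕜) = 0 := by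
    intro B
    induction B using Finset.induction_on with
    | empty => simp
    | insert a B ha ih =>
      intro hj
      rw [Finset.mem_insert, not_or] at hj
      rw [Finset.prod_insert ha, pderiv_mul, pderiv_X_of_ne (Ne.symm hj.1), ih hj.2]
      simp
  split_ifs with hj
  · rw [← Finset.mul_prod_erase B _ hj, pderiv_mul, pderiv_X_self, h0 _ (Finset.notMem_erase j B)]
    simp
  · exact h0 B hj

variable (𝓑 : Finset (Finset σ))

theorem eval_one_sum_prod_X : eval 1 (∑ B ∈ 𝓑, ∏ b ∈ B, X b : MvPolynomial σ 𝕜) = 𝓑.card := by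
  simp

theorem hessianAtOne_sum_prod_X [Fintype σ] [DecidableEq σ] (i j : σ) :
    hessianAtOne (∑ B ∈ 𝓑, ∏ b ∈ B, X b : MvPolynomial σ 𝕜) i j =
      if i = j then 0 else ((𝓑.filter fun B => i ∈ B ∧ j ∈ B).card : 𝕜) := by
  -- Both branches of the conditional are written as sums over `𝓑`, so the claim can be compared
  -- term by term.
  rw [hessianAtOne, Matrix.of_apply, map_sum, map_sum, map_sum, Finset.card_filter,
    Nat.cast_sum, ← Finset.sum_const_zero (s := 𝓑), ← Finset.sum_ite_irrel]
  refine Finset.sum_congr rfl fun B _ => ?_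
  rw [pderiv_prod_X]
  by_cases hj : j ∈ B <;> by_cases hi : i ∈ B <;> by_cases hij : i = j <;>
    simp [hj, hi, hij, pderiv_prod_X]

end SquareFree

/-! ### A decidable test for forests -/

section Forest

variable {V : Type*}

/-- The graph whose edges are the given pairs. -/
def graphOfList (l : List (V × V)) : SimpleGraph V :=
  SimpleGraph.fromEdgeSet {e | ∃ p ∈ l, s(p.1, p.2) = e}

theorem graphOfList_cons (p : V × V) (l : List (V × V)) :
    graphOfList (p :: l) = graphOfList l ⊔ SimpleGraph.edge p.1 p.2 := by
  rw [graphOfList, graphOfList, SimpleGraph.edge, ← SimpleGraph.fromEdgeSet_union]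
  congr 1
  ext e
  simp [eq_comm]

variable [DecidableEq V]

/-- Labels of the connected components of `graphOfList l`. -/
def componentLabel : List (V × V) → V → V
  | [], w => w
  | p :: l, w =>
    -- Adding an edge merges the class of its second endpoint into that of its first.
    if componentLabel l w = componentLabel l p.2 then componentLabel l p.1 else componentLabel l w

theorem componentLabel_eq_iff (l : List (V × V)) (x y : V) :
    componentLabel l x = componentLabel l y ↔ (graphOfList l).Reachable x y := by
  induction l generalizing x y with
  | nil =>
    have : (graphOfList ([] : List (V × V))) = ⊥ := by simp [graphOfList]
    rw [this, SimpleGraph.reachable_bot]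
    rfl
  | cons p l ih =>
    have hle : graphOfList l ≤ graphOfList (p :: l) := graphOfList_cons p l ▸ le_sup_left
    constructor
    · intro h
      have hp : (graphOfList (p :: l)).Reachable p.1 p.2 := by
        by_cases hp : p.1 = p.2
        · rw [hp]
        · refine SimpleGraph.Adj.reachable ?_
          rw [graphOfList, SimpleGraph.fromEdgeSet_adj]
          exact ⟨⟨p, by simp, rfl⟩, hp⟩
      have hm : ∀ {u v : V}, componentLabel l u = componentLabel l v →
          (graphOfList (p :: l)).Reachable u v := fun h => ((ih _ _).1 h).mono hle
      simp only [componentLabel] at h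
      split_ifs at h with h1 h2 h2
      · exact (hm h1).trans (hm h2).symm
      · exact (hm h1).trans (hp.symm.trans (hm h))
      · exact (hm h).trans (hp.trans (hm h2).symm)
      · exact hm h
    · rintro ⟨w⟩
      induction w with
      | nil => rfl
      | @cons u v _ hadj _ ihw =>
        rw [← ihw]
        rw [graphOfList_cons, SimpleGraph.sup_adj] at hadj
        rcases hadj with hadj | hadj
        · simp only [componentLabel, (ih _ _).2 hadj.reachable]
        · rw [SimpleGraph.edge_adj] at hadj
          rcases hadj.1 with ⟨rfl, rfl⟩ | ⟨rfl, rfl⟩ <;> simp [componentLabel]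

/-- Decides whether the given edges form a forest, adding them one at a time. -/
def isForest : List (V × V) → Bool
  | [] => true
  | p :: l => isForest l && decide (componentLabel l p.1 ≠ componentLabel l p.2)

/-- A new edge creates no cycle exactly when its ends lie in different components. Loops and
repeated edges must be excluded: they do not change the graph, but the test rejects them. -/
theorem isForest_iff {l : List (V × V)} (hd : ∀ p ∈ l, p.1 ≠ p.2)
    (hn : (l.map fun p => s(p.1, p.2)).Nodup) : isForest l ↔ (graphOfList l).IsAcyclic := by
  induction l with
  | nil => simp [isForest, graphOfList]
  | cons p l ih =>
    rw [List.map_cons, List.nodup_cons] at hn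
    have hnadj : ¬ (graphOfList l).Adj p.1 p.2 := by
      rw [graphOfList, SimpleGraph.fromEdgeSet_adj]
      rintro ⟨⟨q, hq, h⟩, -⟩
      exact hn.1 (List.mem_map.2 ⟨q, hq, h⟩)
    rw [graphOfList_cons, SimpleGraph.isAcyclic_sup_fromEdgeSet_iff,
      ← ih (fun q hq => hd q (List.mem_cons_of_mem _ hq)) hn.2, ← componentLabel_eq_iff]
    simp [isForest, hd p (by simp), hnadj]

end Forest

/-! ### Bases of truncated graphic matroids -/

section Truncation

theorem truncation_graphicMatroid_isBase_iff {V : Type*} [Finite V] {G : SimpleGraph V}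
    (hG : G.Connected) {r : ℕ} (hr : r < Nat.card V) {B : Set (Sym2 V)} :
    (truncation (graphicMatroid G) r).IsBase B ↔
      B.encard = r ∧ B ⊆ G.edgeSet ∧ (SimpleGraph.fromEdgeSet B).IsAcyclic := by
  rw [truncation_isBase_iff]
  · rw [← Matroid.indep_iff]
    exact Iff.rfl
  -- The rank is the number of edges of a spanning tree, one less than the number of vertices, hence
  -- at least r.
  · obtain ⟨T, hT⟩ := (graphicMatroid G).exists_isBase
    rw [← hT.encard_eq_eRank]
    obtain ⟨hTG, hT'⟩ := (graphicMatroid_isBase_iff hG).1 hT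
    have hc := (SimpleGraph.isTree_iff_connected_and_card.1 hT').2
    have hle : (SimpleGraph.fromEdgeSet T).edgeSet ⊆ T := by
      rw [SimpleGraph.edgeSet_fromEdgeSet]
      exact Set.sdiff_subset
    refine le_trans ?_ (Set.encard_le_encard hle)
    rw [← (Set.toFinite _).cast_ncard_eq, ← Nat.card_coe_set_eq]
    exact_mod_cast (by omega : r ≤ Nat.card (SimpleGraph.fromEdgeSet T).edgeSet)

end Truncation

/-! ### The generating function as a finite sum -/

section MatroidLefschetz

variable {𝕜 α : Type*} [Field 𝕜] {M : Matroid α} [Fintype M.E]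

open scoped Classical in
/-- The bases of `M`, as finite sets of elements of its ground set. -/
noncomputable def baseFinset (M : Matroid α) [Fintype M.E] : Finset (Finset M.E) :=
  Finset.univ.filter fun B => M.IsBase (Subtype.val '' (B : Set M.E))

theorem mem_baseFinset {B : Finset M.E} :
    B ∈ baseFinset M ↔ M.IsBase (Subtype.val '' (B : Set M.E)) := by
  simp [baseFinset]

theorem basisGeneratingFunction_eq_sum :
    basisGeneratingFunction 𝕜 M = ∑ B ∈ baseFinset M, ∏ b ∈ B, X b := by
  classical
  rw [basisGeneratingFunction, finsum_eq_sum_of_fintype, baseFinset, Finset.sum_filter]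
  refine Finset.sum_congr rfl fun B _ => ?_
  rw [finsum_eq_if]

theorem sumOfVariables_eq : sumOfVariables 𝕜 M =
    Ideal.Quotient.mk (annihilator (basisGeneratingFunction 𝕜 M)) (∑ e, X e) := by
  rw [sumOfVariables, finsum_eq_sum_of_fintype]

end MatroidLefschetz

/-! ### Reduction for complete graphs to forest counts and an integer matrix -/

section CompleteGraph

variable {m n r : ℕ} {t : Fin m → Fin n × Fin n}

/-- `t` lists every edge of the complete graph on `Fin n` once. -/
structure IsEdgeList (t : Fin m → Fin n × Fin n) : Prop where
  ne : ∀ i, (t i).1 ≠ (t i).2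
  injective : ∀ i j, s((t i).1, (t i).2) = s((t j).1, (t j).2) → i = j
  surjective : ∀ u v, u ≠ v → ∃ i, s((t i).1, (t i).2) = s(u, v)

/-- The number of forests with `r` edges which contain the edges `i` and `j`. -/
def forestCount (t : Fin m → Fin n × Fin n) (r : ℕ) (i j : Fin m) : ℕ :=
  ((Finset.powersetCard r (Finset.univ : Finset (Fin m))).filter fun B => (i ∈ B ∧ j ∈ B) ∧
    isForest (((List.finRange m).filter (· ∈ B)).map t)).card

/-- `x` if `i = j`, `y` if the edges `i` and `j` have a common vertex, and `z` if they are
disjoint. -/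
def edgePairEntry (t : Fin m → Fin n × Fin n) (x y z : ℤ) (i j : Fin m) : ℤ :=
  if i = j then x
  else if (t i).1 = (t j).1 ∨ (t i).1 = (t j).2 ∨ (t i).2 = (t j).1 ∨ (t i).2 = (t j).2 then y
  else z

/-- The matrix with entries `edgePairEntry t x y z i j`. -/
def edgePairMatrix (t : Fin m → Fin n × Fin n) (x y z : ℤ) : Matrix (Fin m) (Fin m) ℤ :=
  Matrix.of (edgePairEntry t x y z)

local notation "K" n:max r:max => truncation (graphicMatroid (⊤ : SimpleGraph (Fin n))) r

/-- The ground set of the truncation, enumerated by an edge list. -/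
noncomputable def IsEdgeList.equiv (ht : IsEdgeList t) (r : ℕ) : Fin m ≃ (K n r).E :=
  Equiv.ofBijective
    (fun i => ⟨s((t i).1, (t i).2), by
      change _ ∈ (⊤ : SimpleGraph (Fin n)).edgeSet
      simpa using ht.ne i⟩)
    ⟨fun i j h => ht.injective i j (congrArg Subtype.val h), by
      rintro ⟨e, he⟩
      change e ∈ (⊤ : SimpleGraph (Fin n)).edgeSet at he
      induction e with
      | h u v =>
        obtain ⟨i, hi⟩ := ht.surjective u v (by simpa using he)
        exact ⟨i, Subtype.ext hi⟩⟩

theorem IsEdgeList.isBase_iff (ht : IsEdgeList t) (hr : r < n) (B : Finset (Fin m)) :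
    (K n r).IsBase (Subtype.val '' ((ht.equiv r).finsetCongr B : Set (K n r).E)) ↔
      B.card = r ∧ isForest (((List.finRange m).filter (· ∈ B)).map t) := by
  have hinj : Function.Injective fun i => s((t i).1, (t i).2) := fun i j => ht.injective i j
  have himg : Subtype.val '' ((ht.equiv r).finsetCongr B : Set (K n r).E) =
      (fun i => s((t i).1, (t i).2)) '' (B : Set (Fin m)) := by
    rw [Equiv.finsetCongr_apply, Finset.coe_map, Set.image_image]
    rfl
  have : Nonempty (Fin n) := ⟨⟨r, hr⟩⟩
  rw [himg, truncation_graphicMatroid_isBase_iff SimpleGraph.connected_top (by simpa using hr),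
    hinj.encard_image, Set.encard_coe_eq_coe_finsetCard, Nat.cast_inj, isForest_iff]
  · have hg : graphOfList (((List.finRange m).filter (· ∈ B)).map t) =
        SimpleGraph.fromEdgeSet ((fun i => s((t i).1, (t i).2)) '' (B : Set (Fin m))) := by
      rw [graphOfList]
      congr 1
      ext e
      simp
    rw [hg]
    refine and_congr_right fun _ => and_iff_right ?_
    rintro _ ⟨i, -, rfl⟩
    simpa using ht.ne i
  · intro p hp
    obtain ⟨i, -, rfl⟩ := List.mem_map.1 hp
    exact ht.ne i
  · rw [List.map_map]
    exact ((List.nodup_finRange m).filter _).map hinj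

theorem IsEdgeList.card_filter_baseFinset (ht : IsEdgeList t) (hr : r < n) [Fintype (K n r).E]
    [DecidableEq (K n r).E] (i j : Fin m) :
    ((baseFinset (K n r)).filter fun B => ht.equiv r i ∈ B ∧ ht.equiv r j ∈ B).card =
      forestCount t r i j := by
  symm
  refine Finset.card_equiv (ht.equiv r).finsetCongr fun B => ?_
  rw [Finset.mem_filter, Finset.mem_filter, mem_baseFinset, ht.isBase_iff hr,
    Finset.mem_powersetCard_univ, Equiv.finsetCongr_apply]
  simp only [Finset.mem_map_equiv, Equiv.symm_apply_apply]
  tauto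

theorem isHomogeneous_basisGeneratingFunction_truncation (𝕜 : Type*) [Field 𝕜] (hr : r < n) :
    (basisGeneratingFunction 𝕜 (K n r)).IsHomogeneous r := by
  classical
  have : Fintype (K n r).E := Fintype.ofFinite _
  have : Nonempty (Fin n) := ⟨⟨r, hr⟩⟩
  rw [basisGeneratingFunction_eq_sum]
  refine IsHomogeneous.sum _ _ _ fun B hB => ?_
  rw [mem_baseFinset, truncation_graphicMatroid_isBase_iff SimpleGraph.connected_top
    (by simpa using hr), Subtype.val_injective.encard_image, Set.encard_coe_eq_coe_finsetCard,
    Nat.cast_inj] at hB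
  simpa [hB.1] using IsHomogeneous.prod B (fun b => (X b : MvPolynomial (K n r).E 𝕜)) (fun _ => 1)
    fun b _ => isHomogeneous_X 𝕜 b

/-- The strong Lefschetz property for a truncation of the graphic matroid of a complete graph, from
the numbers `x`, `y`, `z` of forests through one edge, two adjacent edges and two disjoint edges, and
an inverse, up to a scalar, of the matrix of these numbers with the diagonal replaced by zero. -/
theorem IsEdgeList.isStrongLefschetzElement (ht : IsEdgeList t) (𝕜 : Type*) [Field 𝕜] [CharZero 𝕜]
    (hr : r < n) (hr4 : r ≤ 4) {x y z x' y' z' d : ℤ} (hd : d ≠ 0) {i₀ j₀ : Fin m}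
    (h₀ : forestCount t r i₀ j₀ ≠ 0)
    (hc : ∀ i j, (forestCount t r i j : ℤ) = edgePairEntry t x y z i j)
    (hinv : ∀ i j, ∑ k, edgePairEntry t x' y' z' i k * edgePairEntry t 0 y z k j =
      if i = j then d else 0) :
    IsStrongLefschetzElement (matroidAlgebraGrading 𝕜 (K n r)) r (sumOfVariables 𝕜 (K n r)) := by
  classical
  have : Fintype (K n r).E := Fintype.ofFinite _
  rw [sumOfVariables_eq]
  refine isStrongLefschetzElement_of_isUnit_hessian
    (isHomogeneous_basisGeneratingFunction_truncation 𝕜 hr) hr4 ?_ ?_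
  · rw [basisGeneratingFunction_eq_sum, eval_one_sum_prod_X, Nat.cast_ne_zero]
    -- One forest through `i₀` and `j₀` already makes the number of bases nonzero.
    rw [← ht.card_filter_baseFinset hr] at h₀
    exact fun h => h₀ (Nat.le_zero.1 (h ▸ Finset.card_filter_le _ _))
  · have hH : (hessianAtOne (basisGeneratingFunction 𝕜 (K n r))).submatrix (ht.equiv r)
        (ht.equiv r) = (edgePairMatrix t 0 y z).map (Int.castRingHom 𝕜) := by
      ext i j
      rw [Matrix.submatrix_apply, basisGeneratingFunction_eq_sum, hessianAtOne_sum_prod_X,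
        Matrix.map_apply]
      by_cases hij : i = j
      · simp [hij, edgePairMatrix, edgePairEntry]
      · have h := hc i j
        rw [edgePairEntry, if_neg hij] at h
        rw [if_neg (by simpa using hij), ht.card_filter_baseFinset hr, edgePairMatrix,
          Matrix.of_apply, edgePairEntry, if_neg hij, ← h]
        simp
    have hmul : edgePairMatrix t x' y' z' * edgePairMatrix t 0 y z =
        d • (1 : Matrix (Fin m) (Fin m) ℤ) := by
      ext i j
      rw [Matrix.mul_apply]
      refine (hinv i j).trans ?_
      rw [Matrix.smul_apply, Matrix.one_apply]
      split_ifs <;> simp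
    -- Taking determinants in the product gives d^m ≠ 0 over ℤ; characteristic zero then carries the
    -- nonvanishing to 𝕜.
    have hdet : (edgePairMatrix t 0 y z).det ≠ 0 := by
      intro h
      have := congrArg Matrix.det hmul
      rw [Matrix.det_mul, h, mul_zero, Matrix.det_smul, Matrix.det_one, mul_one] at this
      exact pow_ne_zero _ hd this.symm
    rw [Matrix.isUnit_iff_isUnit_det, ← Matrix.det_submatrix_equiv_self (ht.equiv r), hH,
      ← RingHom.mapMatrix_apply, ← RingHom.map_det, isUnit_iff_ne_zero]
    simpa using hdet

end CompleteGraph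

/-! ### The three cases (4, 3), (5, 3), (5, 4) -/

section SmallCases

/-- The edges of the complete graph with four vertices. -/
def edgesFour : Fin 6 → Fin 4 × Fin 4 := ![(0, 1), (0, 2), (0, 3), (1, 2), (1, 3), (2, 3)]

/-- The edges of the complete graph with five vertices. -/
def edgesFive : Fin 10 → Fin 5 × Fin 5 :=
  ![(0, 1), (0, 2), (0, 3), (0, 4), (1, 2), (1, 3), (1, 4), (2, 3), (2, 4), (3, 4)]

theorem isEdgeList_edgesFour : IsEdgeList edgesFour :=
  ⟨by decide +kernel, by decide +kernel, by decide +kernel⟩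

theorem isEdgeList_edgesFive : IsEdgeList edgesFive :=
  ⟨by decide +kernel, by decide +kernel, by decide +kernel⟩

/-- Of the four possible third edges, one closes a triangle when the two given edges meet and none
does when they are disjoint. The diagonal value 8 = 16 · 3 / 6 plays no role in the Hessian. -/
theorem forestCount_edgesFour_three (i j : Fin 6) :
    (forestCount edgesFour 3 i j : ℤ) = edgePairEntry edgesFour 8 3 4 i j := by
  decide +kernel +revert

/-- The same count with eight possible third edges. -/
theorem forestCount_edgesFive_three (i j : Fin 10) :
    (forestCount edgesFive 3 i j : ℤ) = edgePairEntry edgesFive 33 7 8 i j := by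
  decide +kernel +revert

/-- The trees on n vertices containing a forest with c components number n^(c-2) times the product
of the component sizes: 5 · 3 for sizes 3, 1, 1 and 5 · 2 · 2 for sizes 2, 2, 1. -/
theorem forestCount_edgesFive_four (i j : Fin 10) :
    (forestCount edgesFive 4 i j : ℤ) = edgePairEntry edgesFive 50 15 20 i j := by
  decide +kernel +revert

theorem isStrongLefschetzElement_complete_four_three (𝕜 : Type*) [Field 𝕜] [CharZero 𝕜] :
    IsStrongLefschetzElement
      (matroidAlgebraGrading 𝕜 (truncation (graphicMatroid (⊤ : SimpleGraph (Fin 4))) 3)) 3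
      (sumOfVariables 𝕜 (truncation (graphicMatroid (⊤ : SimpleGraph (Fin 4))) 3)) :=
  -- An edge of K_4 meets 4 others and misses 1, so the diagonal of the product is 4 · 3 · 3 - 1 · 4
  -- = 32; the ratios of x', y', z' make the off-diagonal entries vanish.
  isEdgeList_edgesFour.isStrongLefschetzElement 𝕜 (x' := -9) (y' := 3) (z' := -1) (d := 32)
    (i₀ := 0) (j₀ := 1) (by norm_num) (by norm_num) (by norm_num) (by decide +kernel)
    forestCount_edgesFour_three (by decide +kernel)

theorem isStrongLefschetzElement_complete_five_three (𝕜 : Type*) [Field 𝕜] [CharZero 𝕜] :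
    IsStrongLefschetzElement
      (matroidAlgebraGrading 𝕜 (truncation (graphicMatroid (⊤ : SimpleGraph (Fin 5))) 3)) 3
      (sumOfVariables 𝕜 (truncation (graphicMatroid (⊤ : SimpleGraph (Fin 5))) 3)) :=
  -- An edge of K_5 meets 6 others and misses 3: d = 6 · 13 · 7 + 3 · 2 · 8.
  isEdgeList_edgesFive.isStrongLefschetzElement 𝕜 (x' := -75) (y' := 13) (z' := 2) (d := 594)
    (i₀ := 0) (j₀ := 1) (by norm_num) (by norm_num) (by norm_num) (by decide +kernel)
    forestCount_edgesFive_three (by decide +kernel)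

theorem isStrongLefschetzElement_complete_five_four (𝕜 : Type*) [Field 𝕜] [CharZero 𝕜] :
    IsStrongLefschetzElement
      (matroidAlgebraGrading 𝕜 (truncation (graphicMatroid (⊤ : SimpleGraph (Fin 5))) 4)) 4
      (sumOfVariables 𝕜 (truncation (graphicMatroid (⊤ : SimpleGraph (Fin 5))) 4)) :=
  -- Likewise d = 6 · 11 · 15 - 3 · 4 · 20.
  isEdgeList_edgesFive.isStrongLefschetzElement 𝕜 (x' := -49) (y' := 11) (z' := -4) (d := 750)
    (i₀ := 0) (j₀ := 1) (by norm_num) (by norm_num) (by norm_num) (by decide +kernel)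
    forestCount_edgesFive_four (by decide +kernel)

end SmallCases

end LefschetzMatroid

theorem mainTheorem7 (𝕜 : Type*) [Field 𝕜] [CharZero 𝕜] (n r : ℕ) (hn : n ≤ 5) (hr : 2 < r)
    (hrn : r < n) :
    LefschetzMatroid.HasStrongLefschetzProperty
        (LefschetzMatroid.matroidAlgebraGrading 𝕜
          (LefschetzMatroid.truncation
            (LefschetzMatroid.graphicMatroid (⊤ : SimpleGraph (Fin n))) r)) ∧
      LefschetzMatroid.IsStrongLefschetzElement
        (LefschetzMatroid.matroidAlgebraGrading 𝕜
          (LefschetzMatroid.truncation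
            (LefschetzMatroid.graphicMatroid (⊤ : SimpleGraph (Fin n))) r))
        r
        (LefschetzMatroid.sumOfVariables 𝕜
          (LefschetzMatroid.truncation
            (LefschetzMatroid.graphicMatroid (⊤ : SimpleGraph (Fin n))) r)) := by
  suffices h : LefschetzMatroid.IsStrongLefschetzElement
      (LefschetzMatroid.matroidAlgebraGrading 𝕜
        (LefschetzMatroid.truncation
          (LefschetzMatroid.graphicMatroid (⊤ : SimpleGraph (Fin n))) r))
      r
      (LefschetzMatroid.sumOfVariables 𝕜
        (LefschetzMatroid.truncation
          (LefschetzMatroid.graphicMatroid (⊤ : SimpleGraph (Fin n))) r)) from ⟨⟨r, _, h⟩, h⟩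
  obtain ⟨rfl, rfl⟩ | ⟨rfl, rfl⟩ | ⟨rfl, rfl⟩ :
      (n = 4 ∧ r = 3) ∨ (n = 5 ∧ r = 3) ∨ (n = 5 ∧ r = 4) := by omega
  · exact LefschetzMatroid.isStrongLefschetzElement_complete_four_three 𝕜
  · exact LefschetzMatroid.isStrongLefschetzElement_complete_five_three 𝕜
  · exact LefschetzMatroid.isStrongLefschetzElement_complete_five_four 𝕜
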